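/- **Theorem (Nonparametric rates).** *Setting.* Let $\mathsf X\subset\mathbb R^{d_x}$, let $T\ge 1$, and let $y_t=f_\star(x_t)+w_t\in\mathbb R^{d_y}$, $t=0,\dots,T-1$, where, for an increasing sequence of $\sigma$-fields $(\mathcal F_t)_{t\ge -1}$, each $x_t\in\mathsf X$ is $\mathcal F_{t-1}$-measurable, each $w_t$ is $\mathcal F_t$-measurable, $\mathbf E[w_t\mid\mathcal F_{t-1}]=0$, and $w_t$ is conditionally $\sigma_w^2$-subgaussian given $\mathcal F_{t-1}$, i.e. $\mathbf E[e^{\lambda\langle w_t,s\rangle}\mid\mathcal F_{t-1}]\le e^{\lambda^2\sigma_w^2/2}$ a.s. for all $\lambda\in\mathbb R$ and all unit vectors $s$. Let $\mathbb F$ be a class of measurable functions $\mathsf X\to\mathbb R^{d_y}$ with $f_\star\in\mathbb F$, which is a metric space under $\rho(f,g)=\sup_{x\in\mathsf X}\|f(x)-g(x)\|_2<\infty$, and let $\mathcal N(\mathbb F,\|\cdot\|_\infty,\delta)$ be the least cardinality of a $\delta$-cover of $(\mathbb F,\rho)$ by elements of $\mathbb F$. Let $P_\star$ be the law of $(x_0,\dots,x_{T-1},y_0,\dots,y_{T-1})$,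 let $$\sigma_T^2(\mathbb F,P_\star)=\inf\Big\{\sigma^2:\ \tfrac1T\sum_{t=0}^{T-1}\|f(x_t)-g(x_t)\|_2\ \text{ is } \sigma^2\text{-subgaussian under }P_\star\text{ for all } f,g\in\mathbb F\Big\},$$ where a real random variable $S$ is $\sigma^2$-subgaussian if $\mathbf E e^{\lambda(S-\mathbf ES)}\le e^{\lambda^2\sigma^2/2}$ for all $\lambda\in\mathbb R$, and assume that $\sigma_T^2(\mathbb F,P_\star)<\infty$. Let $\hat f$ be a least squares estimator, $\hat f\in\arg\min_{f\in\mathbb F}\frac1T\sum_{t=0}^{T-1}\|y_t-f(x_t)\|_2^2$ almost surely (jointly measurable in the sample point and the argument), and let $\xi$ be independent of all other randomness with law the uniform mixture of the laws of $x_0,\dots,x_{T-1}$. *Claim.* For all $K\in\mathbb R$ and $R\ge 0$ there is a constant $C>0$, depending only on $K$ and $R$, such that the following holds in every such setting. Let $p\ge 0$, $0\le q<2$ and $\delta_0\in(0,\infty]$ be such that $$\log\mathcal N(\mathbb F,\|\cdot\|_\infty,\delta)\le K\,p\,\delta^{-q}\qquad\text{for all } 0<\delta\le\delta_0,\ \delta<\infty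 .$$ If the two critical radii satisfy $\left(\frac{p\sigma_w^2}{T}\right)^{\frac1{2+q}}\le R\,\delta_0$ and $\left(p\,\sigma_T^2(\mathbb F,P_\star)\right)^{\frac1{2+q}}\le R\,\delta_0$, then $$\mathbf E\|\hat f(\xi)-f_\star(\xi)\|_2\ \le\ C\left[\sqrt{\frac1{2-q}}\left(\frac{p\sigma_w^2}{T}\right)^{\frac1{2+q}}+\left(p\,\sigma_T^2(\mathbb F,P_\star)\right)^{\frac1{2+q}}\right].$$ In particular (take $\delta_0=\infty$, $R=1$), if the entropy bound holds for all $\delta>0$, then the error bound holds for every $T\ge 1$ with a constant that depends only on $K$. -/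

import Mathlib

open MeasureTheory ProbabilityTheory
open scoped NNReal ENNReal

/-- Euclidean space `ℝ^d` with the norm `‖·‖₂`. -/
abbrev Euc (d : ℕ) : Type := EuclideanSpace ℝ (Fin d)

/-- The metric entropy `log N(F, ρ, δ)`, where `ρ(f, g) = sup_x ‖f x - g x‖₂` and `N(F, ρ, δ)` is
the least cardinality of a `δ`-cover of `F` by elements of `F`; it is `⊤` if there is no finite
`δ`-cover. The type `UniformFun` carries the supremum (extended) distance. -/
noncomputable def metricEntropy {X : Type*} {d : ℕ} (F : Set (X → Euc d)) (δ : ℝ≥0) : EReal :=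
  ENNReal.log ((Metric.coveringNumber δ (UniformFun.ofFun '' F) : ℕ∞) : ℝ≥0∞)

/-- `(F, ρ)` is a metric space: the supremum distance of any two members of `F` is finite. -/
def FiniteSupDist {X : Type*} {d : ℕ} (F : Set (X → Euc d)) : Prop :=
  ∀ f ∈ F, ∀ g ∈ F, edist (UniformFun.ofFun f) (UniformFun.ofFun g) ≠ ⊤

/-- The random vector `W` is conditionally `v`-subgaussian given the σ-field `m`:
`E[exp (λ ⟨W - E[W|m], s⟩) | m] ≤ exp (λ² v / 2)` a.s. for all unit vectors `s` and all real `λ`. -/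
def CondSubgaussian {Ω : Type*} {d : ℕ} (m : MeasurableSpace Ω) {mΩ : MeasurableSpace Ω}
    (μ : Measure Ω) (W : Ω → Euc d) (v : ℝ≥0) : Prop :=
  Integrable W μ ∧
    ∀ s : Euc d, ‖s‖ = 1 → ∀ l : ℝ,
      Integrable (fun ω => Real.exp (l * inner ℝ (W ω - (μ[W | m]) ω) s)) μ ∧
      (μ[fun ω => Real.exp (l * inner ℝ (W ω - (μ[W | m]) ω) s) | m])
        ≤ᵐ[μ] fun _ => Real.exp (l ^ 2 * v / 2)

/-- The time-series model `y_t = f⋆(x_t) + w_t`, `t = 0, …, T - 1`. The σ-field `𝓕 t` of the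
filtration is the σ-field of the information available before the noise `w_t` is drawn: `x_t` is
`𝓕 t`-measurable, `w_t` is `𝓕 (t + 1)`-measurable, and, given `𝓕 t`, it has mean zero and is
`σw²`-subgaussian. -/
structure TimeSeriesModel {Ω : Type*} {mΩ : MeasurableSpace Ω} (μ : Measure Ω)
    (𝓕 : Filtration ℕ mΩ) {dx dy : ℕ} {X : Set (Euc dx)} (T : ℕ) (fstar : X → Euc dy) (σw : ℝ≥0)
    (x : ℕ → Ω → X) (w y : ℕ → Ω → Euc dy) : Prop where
  output_eq : ∀ t < T, ∀ ω, y t ω = fstar (x t ω) + w t ω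
  measurable_covariate : ∀ t < T, Measurable[𝓕 t] (x t)
  measurable_noise : ∀ t < T, Measurable[𝓕 (t + 1)] (w t)
  noise_mean_zero : ∀ t < T, μ[w t | 𝓕 t] =ᵐ[μ] 0
  noise_subgaussian : ∀ t < T, CondSubgaussian (𝓕 t) μ (w t) (σw ^ 2)

/-- The joint law `P⋆` of `Z = (x_0, …, x_{T-1}, y_0, …, y_{T-1})`. -/
noncomputable def trajectoryLaw {Ω : Type*} {mΩ : MeasurableSpace Ω} (μ : Measure Ω)
    {dx dy : ℕ} {X : Set (Euc dx)} (T : ℕ) (x : ℕ → Ω → X) (y : ℕ → Ω → Euc dy) :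
    Measure ((Fin T → X) × (Fin T → Euc dy)) :=
  μ.map fun ω => (fun t : Fin T => x t ω, fun t : Fin T => y t ω)

/-- The statistic `(1/T) ∑_{t<T} ‖f(x_t) - g(x_t)‖₂` of a trajectory. -/
noncomputable def avgDist {X : Type*} {dy T : ℕ} (f g : X → Euc dy)
    (z : (Fin T → X) × (Fin T → Euc dy)) : ℝ :=
  (1 / (T : ℝ)) * ∑ t : Fin T, ‖f (z.1 t) - g (z.1 t)‖

/-- The variance proxy `σ_T²(F, P)`: the infimum of all `v` such that for all `f, g ∈ F` the
statistic `(1/T) ∑_t ‖f(x_t) - g(x_t)‖₂` (after centring) is `v`-subgaussian under `P`; it is `⊤` if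
there is no such `v`. -/
noncomputable def varianceProxy {X : Type*} [MeasurableSpace X] {dy T : ℕ} (F : Set (X → Euc dy))
    (P : Measure ((Fin T → X) × (Fin T → Euc dy))) : ℝ≥0∞ :=
  ⨅ (v : ℝ≥0) (_ : ∀ f ∈ F, ∀ g ∈ F,
    HasSubgaussianMGF (fun z => avgDist f g z - ∫ z', avgDist f g z' ∂P) v P), (v : ℝ≥0∞)

/-- `g` is a least squares estimate over `F` for the data `(x_t, y_t)`, `t < T`. -/
def IsLeastSquares {X : Type*} {dy : ℕ} (F : Set (X → Euc dy)) (T : ℕ) (x : ℕ → X)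
    (y : ℕ → Euc dy) (g : X → Euc dy) : Prop :=
  g ∈ F ∧ ∀ f ∈ F,
    (1 / (T : ℝ)) * ∑ t ∈ Finset.range T, ‖y t - g (x t)‖ ^ 2
      ≤ (1 / (T : ℝ)) * ∑ t ∈ Finset.range T, ‖y t - f (x t)‖ ^ 2

/-- The uniform mixture `ν` of the laws of `x_0, …, x_{T-1}`. -/
noncomputable def mixtureLaw {Ω : Type*} {mΩ : MeasurableSpace Ω} (μ : Measure Ω)
    {X : Type*} [MeasurableSpace X] (T : ℕ) (x : ℕ → Ω → X) : Measure X :=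
  (T : ℝ≥0∞)⁻¹ • ∑ t ∈ Finset.range T, μ.map (x t)

/-- The error `E ‖f̂(ξ) - f⋆(ξ)‖₂`, where `ξ` has law `ν` and is independent of `f̂`. -/
noncomputable def expectedError {Ω : Type*} {mΩ : MeasurableSpace Ω} (μ : Measure Ω)
    {X : Type*} [MeasurableSpace X] {dy : ℕ} (T : ℕ) (x : ℕ → Ω → X) (fhat : Ω → X → Euc dy)
    (fstar : X → Euc dy) : ℝ≥0∞ :=
  ∫⁻ z, ‖fhat z.1 z.2 - fstar z.2‖ₑ ∂(μ.prod (mixtureLaw μ T x))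

/-! Let `D` be the empirical sum of squares of `f̂ - f⋆`. Optimality of `f̂` gives `D ≤ 2 ∑ ⟨w_t,
(f̂ - f⋆)(x_t)⟩`, hence `D ≤ 4 ∑ ⟨w_t, (f̂ - f⋆)(x_t)⟩ - D`. Up to `O(T γ²)`, the term `-D` can be
moved to a point `g` of a `γ`-net near `f̂`, where it compensates the noise: at small rates the
offset process has exponential moment at most 1, so its maximum over the net costs a multiple of
`σw² log N(γ)` (`exists_offset_bound`). The passage from `g` to `f̂` is paid by chaining
(`exists_chaining_bound`); as `q < 2`, the level costs form a geometric series of ratio `2^(-(1 -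
q/2))`, with sum at most `4 / (2 - q)`. When `γ^(2+q)` is of order `p σw² / T`, the mean squared
error is `O(γ² / (2 - q))`.

For a fixed `f`, the mean of the empirical `L¹` distance to `f⋆` is exactly the error at `ξ`. The
proxy `σ_T²` controls its deviation, uniformly over a `δ`-net, at cost `O(δ)` when `δ^(2+q)` is of
order `p σ_T²` (`exists_deviation_bound`). Dependence between the times enters only through `σ_T²`
and the noise supermartingale `lintegral_exp_sum_inner_le_one`.

Since `f̂` is random and `F` may be uncountable, each maximal inequality supplies one integrable `Y`
that dominates pointwise. It can be evaluated at `f̂ ω` without any measurability of suprema. -/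

lemma Measurable.exists_finite_range_tendsto {Ω : Type*} {m : MeasurableSpace Ω} {d : ℕ}
    {u : Ω → Euc d} (hu : Measurable u) : ∃ φ : ℕ → Ω → Euc d, (∀ n, Measurable (φ n)) ∧
      (∀ n, (Set.range (φ n)).Finite) ∧
      ∀ ω, Filter.Tendsto (fun n => φ n ω) Filter.atTop (nhds (u ω)) :=
  ⟨fun n => hu.stronglyMeasurable.approx n, fun _ => SimpleFunc.measurable _,
    fun _ => SimpleFunc.finite_range _, hu.stronglyMeasurable.tendsto_approx⟩

/-! ### Exponential moments of conditionally subgaussian noise -/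

section CondSubgaussian

variable {Ω : Type*} {m mΩ : MeasurableSpace Ω} {μ : Measure Ω} [IsProbabilityMeasure μ]
  {d : ℕ} {W : Ω → Euc d} {v : ℝ≥0}

/-- The hypothesis is applied to the unit vector `z / ‖z‖` with parameter `‖z‖` and integrated over
`A`; this is the conditional bound in a form that compares measures. -/
lemma CondSubgaussian.setLIntegral_exp_inner_le (hm : m ≤ mΩ) (h : CondSubgaussian m μ W v)
    (h0 : μ[W | m] =ᵐ[μ] 0) (z : Euc d) {A : Set Ω} (hA : MeasurableSet[m] A) :
    ∫⁻ ω in A, ENNReal.ofReal (Real.exp (inner ℝ (W ω) z - v * ‖z‖ ^ 2 / 2)) ∂μ ≤ μ A := by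
  rcases eq_or_ne z 0 with rfl | hz
  · simp
  have hz' : ‖z‖ ≠ 0 := norm_ne_zero_iff.2 hz
  obtain ⟨hint, hle⟩ := h.2 (‖z‖⁻¹ • z) (by rw [norm_smul, norm_inv, norm_norm,
    inv_mul_cancel₀ hz']) ‖z‖
  set f : Ω → ℝ := fun ω => Real.exp (‖z‖ * inner ℝ (W ω - (μ[W | m]) ω) (‖z‖⁻¹ • z)) with hf
  have hfe : ∀ᵐ ω ∂μ, f ω = Real.exp (inner ℝ (W ω) z) := by
    filter_upwards [h0] with ω hω
    simp only [hf, hω, Pi.zero_apply, sub_zero, inner_smul_right]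
    rw [mul_inv_cancel_left₀ hz']
  have h1 : ∫ ω in A, f ω ∂μ ≤ Real.exp (v * ‖z‖ ^ 2 / 2) * μ.real A := by
    rw [← setIntegral_condExp hm hint hA]
    calc ∫ ω in A, (μ[f | m]) ω ∂μ
        ≤ ∫ _ in A, Real.exp (‖z‖ ^ 2 * v / 2) ∂μ :=
          setIntegral_mono_ae integrable_condExp.integrableOn (integrable_const _).integrableOn hle
      _ = _ := by rw [setIntegral_const, smul_eq_mul, mul_comm, mul_comm (v : ℝ)]
  calc ∫⁻ ω in A, ENNReal.ofReal (Real.exp (inner ℝ (W ω) z - v * ‖z‖ ^ 2 / 2)) ∂μ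
      = ∫⁻ ω in A, ENNReal.ofReal (Real.exp (-(v * ‖z‖ ^ 2 / 2))) * ENNReal.ofReal (f ω) ∂μ := by
        refine lintegral_congr_ae (ae_restrict_of_ae ?_)
        filter_upwards [hfe] with ω hω
        rw [hω, ← ENNReal.ofReal_mul (Real.exp_nonneg _), ← Real.exp_add]
        congr 2; ring
    _ = ENNReal.ofReal (Real.exp (-(v * ‖z‖ ^ 2 / 2))) * ENNReal.ofReal (∫ ω in A, f ω ∂μ) := by
        rw [lintegral_const_mul' _ _ ENNReal.ofReal_ne_top,
          ofReal_integral_eq_lintegral_ofReal hint.integrableOn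
            (Filter.Eventually.of_forall fun ω => Real.exp_nonneg _)]
    _ ≤ ENNReal.ofReal (Real.exp (-(v * ‖z‖ ^ 2 / 2)) *
          (Real.exp (v * ‖z‖ ^ 2 / 2) * μ.real A)) := by
        rw [← ENNReal.ofReal_mul (Real.exp_nonneg _)]
        gcongr
    _ = μ A := by
        rw [← mul_assoc, ← Real.exp_add, neg_add_cancel, Real.exp_zero, one_mul,
          ofReal_measureReal]

lemma CondSubgaussian.lintegral_mul_exp_inner_const_le (hm : m ≤ mΩ) (h : CondSubgaussian m μ W v)
    (h0 : μ[W | m] =ᵐ[μ] 0) (hW : Measurable W) (z : Euc d) {G : Ω → ℝ≥0∞} (hG : Measurable[m] G) :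
    ∫⁻ ω, G ω * ENNReal.ofReal (Real.exp (inner ℝ (W ω) z - v * ‖z‖ ^ 2 / 2)) ∂μ
      ≤ ∫⁻ ω, G ω ∂μ := by
  set e : Ω → ℝ≥0∞ := fun ω => ENNReal.ofReal (Real.exp (inner ℝ (W ω) z - v * ‖z‖ ^ 2 / 2))
  have he : Measurable e := by fun_prop
  -- The set bound says that the measure with density `e` is dominated by `μ` on `m`, so no
  -- integrability of `G` is needed.
  have hle : (μ.withDensity e).trim hm ≤ μ.trim hm := by
    rw [Measure.le_iff]
    intro A hA
    rw [trim_measurableSet_eq hm hA, trim_measurableSet_eq hm hA, withDensity_apply _ (hm _ hA)]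
    exact h.setLIntegral_exp_inner_le hm h0 z hA
  calc ∫⁻ ω, G ω * e ω ∂μ = ∫⁻ ω, G ω ∂(μ.withDensity e) := by
        rw [lintegral_withDensity_eq_lintegral_mul _ he (hG.mono hm le_rfl)]
        simp [mul_comm]
    _ = ∫⁻ ω, G ω ∂(μ.withDensity e).trim hm := (lintegral_trim hm hG).symm
    _ ≤ ∫⁻ ω, G ω ∂μ.trim hm := lintegral_mono' hle le_rfl
    _ = _ := lintegral_trim hm hG

/-- The level sets of `u` lie in `m` and `u` is constant on each, so their indicators can be
absorbed into `G`. -/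
lemma CondSubgaussian.lintegral_mul_exp_inner_le_of_finite_range (hm : m ≤ mΩ)
    (h : CondSubgaussian m μ W v) (h0 : μ[W | m] =ᵐ[μ] 0) (hW : Measurable W) {u : Ω → Euc d}
    (hu : Measurable[m] u) (hfin : (Set.range u).Finite) {G : Ω → ℝ≥0∞} (hG : Measurable[m] G) :
    ∫⁻ ω, G ω * ENNReal.ofReal (Real.exp (inner ℝ (W ω) (u ω) - v * ‖u ω‖ ^ 2 / 2)) ∂μ
      ≤ ∫⁻ ω, G ω ∂μ := by
  have hGm : Measurable G := hG.mono hm le_rfl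
  have hind : ∀ m' : MeasurableSpace Ω, Measurable[m'] u →
      ∀ z, Measurable[m'] ((u ⁻¹' {z}).indicator (1 : Ω → ℝ≥0∞)) := fun m' hu' z =>
    measurable_one.indicator (hu' (measurableSet_singleton z))
  have hindm := hind mΩ (hu.mono hm le_rfl)
  have hsum : ∀ ω, ∑ z ∈ hfin.toFinset, (u ⁻¹' {z}).indicator (1 : Ω → ℝ≥0∞) ω = 1 := by
    intro ω
    rw [Finset.sum_eq_single_of_mem (u ω) (by simp)]
    · simp
    · intro z _ hz
      simp [hz.symm]
  calc _ = ∫⁻ ω, ∑ z ∈ hfin.toFinset, ((u ⁻¹' {z}).indicator (1 : Ω → ℝ≥0∞) ω * G ω) *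
          ENNReal.ofReal (Real.exp (inner ℝ (W ω) z - v * ‖z‖ ^ 2 / 2)) ∂μ := by
        refine lintegral_congr fun ω => ?_
        rw [Finset.sum_eq_single_of_mem (u ω) (by simp)]
        · simp
        · intro z _ hz
          simp [hz.symm]
    _ = ∑ z ∈ hfin.toFinset, ∫⁻ ω, ((u ⁻¹' {z}).indicator (1 : Ω → ℝ≥0∞) ω * G ω) *
          ENNReal.ofReal (Real.exp (inner ℝ (W ω) z - v * ‖z‖ ^ 2 / 2)) ∂μ :=
        lintegral_finsetSum _ fun z _ => ((hindm z).mul hGm).mul (by fun_prop)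
    _ ≤ ∑ z ∈ hfin.toFinset, ∫⁻ ω, (u ⁻¹' {z}).indicator (1 : Ω → ℝ≥0∞) ω * G ω ∂μ :=
        Finset.sum_le_sum fun z _ =>
          h.lintegral_mul_exp_inner_const_le hm h0 hW z (Measurable.mul (hind m hu z) hG)
    _ = ∫⁻ ω, G ω ∂μ := by
        have := lintegral_finsetSum (μ := μ) hfin.toFinset fun z _ => (hindm z).mul hGm
        simp_rw [Pi.mul_apply] at this
        rw [← this]
        simp_rw [← Finset.sum_mul, hsum, one_mul]

/-- A conditionally subgaussian vector may be tested against any random direction that is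
measurable with respect to the conditioning σ-field. -/
lemma CondSubgaussian.lintegral_mul_exp_inner_le (hm : m ≤ mΩ) (h : CondSubgaussian m μ W v)
    (h0 : μ[W | m] =ᵐ[μ] 0) (hW : Measurable W) {u : Ω → Euc d} (hu : Measurable[m] u)
    {G : Ω → ℝ≥0∞} (hG : Measurable[m] G) :
    ∫⁻ ω, G ω * ENNReal.ofReal (Real.exp (inner ℝ (W ω) (u ω) - v * ‖u ω‖ ^ 2 / 2)) ∂μ
      ≤ ∫⁻ ω, G ω ∂μ := by
  obtain ⟨φ, hφm, hφfin, hφt⟩ := hu.exists_finite_range_tendsto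
  have hGm : Measurable G := hG.mono hm le_rfl
  have hφ : ∀ n, Measurable (φ n) := fun n => (hφm n).mono hm le_rfl
  -- Fatou suffices, as only an upper bound is wanted; the exponentials need not be dominated.
  calc _ ≤ ∫⁻ ω, Filter.liminf (fun n => G ω * ENNReal.ofReal (Real.exp
          (inner ℝ (W ω) (φ n ω) - v * ‖φ n ω‖ ^ 2 / 2))) Filter.atTop ∂μ := by
        refine lintegral_mono fun ω => le_of_eq (Filter.Tendsto.liminf_eq ?_).symm
        have ht := hφt ω
        refine ENNReal.Tendsto.const_mul ?_ (Or.inl ?_)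
        · refine (ENNReal.continuous_ofReal.tendsto _).comp ((Real.continuous_exp.tendsto _).comp ?_)
          refine Filter.Tendsto.sub (Filter.Tendsto.inner tendsto_const_nhds ht) ?_
          exact ((ht.norm.pow 2).const_mul _).div_const _
        · exact (ENNReal.ofReal_pos.2 (Real.exp_pos _)).ne'
    _ ≤ Filter.liminf (fun n => ∫⁻ ω, G ω * ENNReal.ofReal (Real.exp
          (inner ℝ (W ω) (φ n ω) - v * ‖φ n ω‖ ^ 2 / 2)) ∂μ) Filter.atTop :=
        lintegral_liminf_le fun n => by
          have := hφ n
          fun_prop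
    _ ≤ Filter.liminf (fun _ : ℕ => ∫⁻ ω, G ω ∂μ) Filter.atTop :=
        Filter.liminf_le_liminf (Filter.Eventually.of_forall fun n =>
          h.lintegral_mul_exp_inner_le_of_finite_range hm h0 hW (hφm n) (hφfin n) hG)
    _ = ∫⁻ ω, G ω ∂μ := Filter.Tendsto.liminf_eq tendsto_const_nhds

/-- The exponential supermartingale of a conditionally subgaussian noise sequence. -/
lemma lintegral_exp_sum_inner_le_one {𝓕 : Filtration ℕ mΩ} {w u : ℕ → Ω → Euc d} (T : ℕ)
    (hw : ∀ t < T, Measurable[𝓕 (t + 1)] (w t)) (hu : ∀ t < T, Measurable[𝓕 t] (u t))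
    (h0 : ∀ t < T, μ[w t | 𝓕 t] =ᵐ[μ] 0) (h : ∀ t < T, CondSubgaussian (𝓕 t) μ (w t) v) :
    ∫⁻ ω, ENNReal.ofReal (Real.exp (∑ t ∈ Finset.range T,
      (inner ℝ (w t ω) (u t ω) - v * ‖u t ω‖ ^ 2 / 2))) ∂μ ≤ 1 := by
  induction T with
  | zero => simp
  | succ n ih =>
    have hmeas : Measurable[𝓕 n] fun ω => ENNReal.ofReal (Real.exp (∑ t ∈ Finset.range n,
        (inner ℝ (w t ω) (u t ω) - v * ‖u t ω‖ ^ 2 / 2))) := by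
      refine ENNReal.measurable_ofReal.comp (Real.measurable_exp.comp ?_)
      refine Finset.measurable_sum _ fun t ht => ?_
      have htn := Finset.mem_range.1 ht
      have hw' : Measurable[𝓕 n] (w t) := (hw t (by omega)).mono (𝓕.mono htn) le_rfl
      have hu' : Measurable[𝓕 n] (u t) := (hu t (by omega)).mono (𝓕.mono htn.le) le_rfl
      have key : ∀ m' : MeasurableSpace Ω, Measurable[m'] (w t) → Measurable[m'] (u t) →
          Measurable[m'] fun ω => inner ℝ (w t ω) (u t ω) - v * ‖u t ω‖ ^ 2 / 2 := by
        intro m' h1 h2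
        fun_prop
      exact key _ hw' hu'
    simp_rw [Finset.sum_range_succ _ n, Real.exp_add, ENNReal.ofReal_mul (Real.exp_nonneg _)]
    refine ((h n n.lt_succ_self).lintegral_mul_exp_inner_le (𝓕.le n) (h0 n n.lt_succ_self)
      ((hw n n.lt_succ_self).mono (𝓕.le _) le_rfl) (hu n n.lt_succ_self) hmeas).trans ?_
    exact ih (fun t ht => hw t (by omega)) (fun t ht => hu t (by omega))
      (fun t ht => h0 t (by omega)) (fun t ht => h t (by omega))

/-- A maximal inequality for a finite family with controlled exponential moments, in the form of an
integrable pointwise upper bound. -/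
lemma exists_integrable_bound_of_exp_moment {ι : Type*} {s : Finset ι} (hs : s.Nonempty)
    {Z : ι → Ω → ℝ} (hZ : ∀ i ∈ s, Measurable (Z i)) {l L b : ℝ} (hl : 0 < l)
    (hL : Real.log s.card ≤ L)
    (h : ∀ i ∈ s, ∫⁻ ω, ENNReal.ofReal (Real.exp (l * Z i ω)) ∂μ ≤ ENNReal.ofReal (Real.exp b)) :
    ∃ Y : Ω → ℝ, Integrable Y μ ∧ ∫ ω, Y ω ∂μ ≤ (L + b) / l ∧ ∀ ω, ∀ i ∈ s, Z i ω ≤ Y ω := by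
  have hcard : (0 : ℝ) < s.card := by exact_mod_cast hs.card_pos
  have hint : ∀ i ∈ s, Integrable (fun ω => Real.exp (l * Z i ω)) μ := fun i hi => by
    have := hZ i hi
    refine ⟨by fun_prop, ?_⟩
    rw [hasFiniteIntegral_iff_ofReal (Filter.Eventually.of_forall fun ω => Real.exp_nonneg _)]
    exact (h i hi).trans_lt ENNReal.ofReal_lt_top
  have hle : ∀ i ∈ s, ∫ ω, Real.exp (l * Z i ω) ∂μ ≤ Real.exp b := fun i hi => by
    rw [← ENNReal.ofReal_le_ofReal_iff (Real.exp_nonneg _), ofReal_integral_eq_lintegral_ofReal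
      (hint i hi) (Filter.Eventually.of_forall fun ω => Real.exp_nonneg _)]
    exact h i hi
  have hsint : Integrable (fun ω => ∑ i ∈ s, Real.exp (l * Z i ω)) μ :=
    integrable_finsetSum _ hint
  set a : ℝ := Real.log s.card + b with ha
  have hea : Real.exp a = s.card * Real.exp b := by rw [ha, Real.exp_add, Real.exp_log hcard]
  -- The tangent to `log` at `exp a` bounds the log-sum-exp by an affine function of the sum, whose
  -- mean is at most `exp a`.
  refine ⟨fun ω => (a + Real.exp (-a) * ∑ i ∈ s, Real.exp (l * Z i ω) - 1) / l, ?_, ?_, ?_⟩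
  · exact (((integrable_const a).add (hsint.const_mul _)).sub (integrable_const _)).div_const _
  · have h1 : Integrable (fun ω => Real.exp (-a) * ∑ i ∈ s, Real.exp (l * Z i ω)) μ :=
      hsint.const_mul _
    have h2 : Integrable (fun ω => a + Real.exp (-a) * ∑ i ∈ s, Real.exp (l * Z i ω)) μ :=
      (integrable_const a).add h1
    rw [integral_div, integral_sub h2 (integrable_const _), integral_add (integrable_const a) h1,
      integral_const_mul, integral_finsetSum _ hint]
    simp only [integral_const, probReal_univ, smul_eq_mul, mul_one]
    gcongr
    have : Real.exp (-a) * ∑ i ∈ s, ∫ ω, Real.exp (l * Z i ω) ∂μ ≤ 1 := by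
      calc _ ≤ Real.exp (-a) * ∑ i ∈ s, Real.exp b := by
            gcongr with i hi
            exact hle i hi
        _ = 1 := by rw [Finset.sum_const, nsmul_eq_mul, ← hea, ← Real.exp_add]; simp
    linarith
  · intro ω i hi
    rw [le_div_iff₀ hl]
    have h1 : Real.exp (l * Z i ω) ≤ ∑ i ∈ s, Real.exp (l * Z i ω) :=
      Finset.single_le_sum (f := fun i => Real.exp (l * Z i ω)) (fun _ _ => Real.exp_nonneg _) hi
    have h2 := Real.add_one_le_exp (l * Z i ω - a)
    have h3 : Real.exp (l * Z i ω - a) = Real.exp (-a) * Real.exp (l * Z i ω) := by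
      rw [← Real.exp_add]; ring_nf
    have h4 := mul_le_mul_of_nonneg_left h1 (Real.exp_nonneg (-a))
    nlinarith

end CondSubgaussian

/-! ### Finite nets from metric entropy -/

section Nets

variable {X : Type*} {d : ℕ} {F : Set (X → Euc d)}

lemma exists_finset_cover_of_metricEntropy_le (hF : F.Nonempty) {δ : ℝ≥0} {L : ℝ}
    (h : metricEntropy F δ ≤ (L : EReal)) :
    ∃ C : Finset (X → Euc d), C.Nonempty ∧ (∀ g ∈ C, g ∈ F) ∧ Real.log C.card ≤ L ∧
      ∀ f ∈ F, ∃ g ∈ C, ∀ x, ‖f x - g x‖ ≤ δ := by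
  classical
  have hne : Metric.coveringNumber δ (UniformFun.ofFun '' F) ≠ ⊤ := by
    intro htop
    simp [metricEntropy, htop] at h
  obtain ⟨C, hCF, hfin, hcov, hcard⟩ := Metric.exists_set_encard_eq_coveringNumber hne
  set D : Finset (X → Euc d) := hfin.toFinset.image UniformFun.toFun with hD
  have hDcard : D.card = hfin.toFinset.card :=
    Finset.card_image_of_injective _ UniformFun.toFun.injective
  have hcover : ∀ f ∈ F, ∃ g ∈ D, ∀ x, ‖f x - g x‖ ≤ δ := by
    intro f hf
    obtain ⟨g, hg, hfg⟩ := hcov (Set.mem_image_of_mem _ hf)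
    refine ⟨UniformFun.toFun g, Finset.mem_image_of_mem _ (by simpa using hg), fun x => ?_⟩
    have h1 := UniformFun.edist_le.1 hfg x
    rw [edist_eq_enorm_sub] at h1
    have h2 : ‖f x - UniformFun.toFun g x‖ₑ ≤ (δ : ℝ≥0∞) := h1
    rw [← ofReal_norm, ← ENNReal.ofReal_coe_nnreal,
      ENNReal.ofReal_le_ofReal_iff δ.coe_nonneg] at h2
    exact h2
  obtain ⟨f, hf⟩ := hF
  obtain ⟨g, hg, -⟩ := hcover f hf
  have hpos : 0 < D.card := Finset.card_pos.2 ⟨g, hg⟩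
  refine ⟨D, ⟨g, hg⟩, ?_, ?_, hcover⟩
  · intro g hg
    obtain ⟨g', hg', rfl⟩ := Finset.mem_image.1 hg
    obtain ⟨f, hf, rfl⟩ := hCF (hfin.mem_toFinset.1 hg')
    exact hf
  · have h1 : ((Metric.coveringNumber δ (UniformFun.ofFun '' F) : ℕ∞) : ℝ≥0∞)
        = ENNReal.ofReal (D.card : ℝ) := by
      rw [← hcard, hfin.encard_eq_coe_toFinset_card, ← hDcard]
      simp
    rw [metricEntropy, h1, ENNReal.log_ofReal_of_pos (by exact_mod_cast hpos)] at h
    exact_mod_cast h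

lemma FiniteSupDist.exists_bound (hF : FiniteSupDist F) {f g : X → Euc d} (hf : f ∈ F)
    (hg : g ∈ F) : ∃ B : ℝ, 0 ≤ B ∧ ∀ x, ‖f x - g x‖ ≤ B := by
  refine ⟨(edist (UniformFun.ofFun f) (UniformFun.ofFun g)).toReal, ENNReal.toReal_nonneg,
    fun x => ?_⟩
  have h : edist (f x) (g x) ≤ edist (UniformFun.ofFun f) (UniformFun.ofFun g) :=
    UniformFun.edist_eval_le (f := UniformFun.ofFun f) (g := UniformFun.ofFun g) (x := x)
  rw [← dist_eq_norm, dist_edist]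
  exact ENNReal.toReal_mono (hF f hf g hg) h

end Nets

/-! ### Basic inequality, offset bound and chaining -/

section LeastSquares

variable {Ω : Type*} {mΩ : MeasurableSpace Ω} {μ : Measure Ω}
  {𝓕 : Filtration ℕ mΩ} {dx dy : ℕ} {X : Set (Euc dx)} {F : Set (X → Euc dy)}
  {fstar : X → Euc dy} {σw : ℝ≥0} {T : ℕ} {x : ℕ → Ω → X} {w y : ℕ → Ω → Euc dy}

namespace TimeSeriesModel

lemma measurable_x (M : TimeSeriesModel μ 𝓕 T fstar σw x w y) {t : ℕ} (ht : t < T) :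
    Measurable (x t) := (M.measurable_covariate t ht).mono (𝓕.le t) le_rfl

lemma measurable_w (M : TimeSeriesModel μ 𝓕 T fstar σw x w y) {t : ℕ} (ht : t < T) :
    Measurable (w t) := (M.measurable_noise t ht).mono (𝓕.le _) le_rfl

/-- The basic inequality for least squares. -/
lemma sum_norm_sq_le (M : TimeSeriesModel μ 𝓕 T fstar σw x w y) (hT : 1 ≤ T)
    (hstar : fstar ∈ F) {ω : Ω} {f : X → Euc dy}
    (hf : IsLeastSquares F T (fun t => x t ω) (fun t => y t ω) f) :
    ∑ t ∈ Finset.range T, ‖f (x t ω) - fstar (x t ω)‖ ^ 2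
      ≤ 2 * ∑ t ∈ Finset.range T, inner ℝ (w t ω) (f (x t ω) - fstar (x t ω)) := by
  have hT' : (0 : ℝ) < 1 / T := by positivity
  have h := le_of_mul_le_mul_left (hf.2 fstar hstar) hT'
  have h1 : ∀ t ∈ Finset.range T, ‖y t ω - f (x t ω)‖ ^ 2 = ‖y t ω - fstar (x t ω)‖ ^ 2
      - 2 * inner ℝ (w t ω) (f (x t ω) - fstar (x t ω)) + ‖f (x t ω) - fstar (x t ω)‖ ^ 2 := by
    intro t ht
    rw [M.output_eq t (Finset.mem_range.1 ht) ω, add_sub_cancel_left, ← norm_sub_sq_real]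
    congr 2
    abel
  rw [Finset.sum_congr rfl h1, Finset.sum_add_distrib, Finset.sum_sub_distrib,
    ← Finset.mul_sum] at h
  linarith

lemma measurable_sum_inner (M : TimeSeriesModel μ 𝓕 T fstar σw x w y) {h : X → Euc dy}
    (hh : Measurable h) :
    Measurable fun ω => ∑ t ∈ Finset.range T, inner ℝ (w t ω) (h (x t ω)) := by
  refine Finset.measurable_sum _ fun t ht => ?_
  have h1 := M.measurable_w (Finset.mem_range.1 ht)
  have h2 := hh.comp (M.measurable_x (Finset.mem_range.1 ht))
  exact h1.inner h2

variable [IsProbabilityMeasure μ]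

lemma lintegral_exp_noise_le_one (M : TimeSeriesModel μ 𝓕 T fstar σw x w y) {h : X → Euc dy}
    (hh : Measurable h) :
    ∫⁻ ω, ENNReal.ofReal (Real.exp (∑ t ∈ Finset.range T,
      (inner ℝ (w t ω) (h (x t ω)) - σw ^ 2 * ‖h (x t ω)‖ ^ 2 / 2))) ∂μ ≤ 1 := by
  have := lintegral_exp_sum_inner_le_one (v := σw ^ 2) (u := fun t ω => h (x t ω)) T
    M.measurable_noise (fun t ht => hh.comp (M.measurable_covariate t ht)) M.noise_mean_zero
    M.noise_subgaussian
  simpa using this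

/-- Offset maximal inequality over a finite class. -/
lemma exists_offset_bound (M : TimeSeriesModel μ 𝓕 T fstar σw x w y) {C : Finset (X → Euc dy)}
    (hC : C.Nonempty) (hCm : ∀ g ∈ C, Measurable g) (hf : Measurable fstar) {l L : ℝ} (hl : 0 < l)
    (hlσ : 16 * l * σw ^ 2 ≤ 1) (hL : Real.log C.card ≤ L) :
    ∃ Y : Ω → ℝ, Integrable Y μ ∧ ∫ ω, Y ω ∂μ ≤ L / l ∧ ∀ ω, ∀ g ∈ C,
      4 * ∑ t ∈ Finset.range T, inner ℝ (w t ω) (g (x t ω) - fstar (x t ω))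
        - (∑ t ∈ Finset.range T, ‖g (x t ω) - fstar (x t ω)‖ ^ 2) / 2 ≤ Y ω := by
  have key := exists_integrable_bound_of_exp_moment (μ := μ) (b := 0) hC
    (Z := fun g ω => 4 * ∑ t ∈ Finset.range T, inner ℝ (w t ω) (g (x t ω) - fstar (x t ω))
        - (∑ t ∈ Finset.range T, ‖g (x t ω) - fstar (x t ω)‖ ^ 2) / 2) ?_ hl hL ?_
  · simpa using key
  · intro g hg
    have h1 := M.measurable_sum_inner ((hCm g hg).sub hf)
    refine (h1.const_mul 4).sub (Measurable.div_const (Finset.measurable_sum _ fun t ht => ?_) _)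
    have h2 := ((hCm g hg).sub hf).comp (M.measurable_x (Finset.mem_range.1 ht))
    exact h2.norm.pow_const 2
  · intro g hg
    rw [Real.exp_zero, ENNReal.ofReal_one]
    -- In direction `4l(g - f⋆)` the compensator is `8 l² σw² ‖g - f⋆‖²`, which `hlσ` bounds by the
    -- offset `l ‖g - f⋆‖² / 2`.
    refine le_trans (lintegral_mono fun ω => ENNReal.ofReal_le_ofReal (Real.exp_le_exp.2 ?_))
      (M.lintegral_exp_noise_le_one (h := fun z => (4 * l) • (g z - fstar z))
        (((hCm g hg).sub hf).const_smul (4 * l)))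
    rw [Finset.mul_sum, Finset.sum_div, ← Finset.sum_sub_distrib, Finset.mul_sum]
    refine Finset.sum_le_sum fun t _ => ?_
    rw [inner_smul_right, norm_smul, Real.norm_of_nonneg (by positivity)]
    nlinarith [mul_le_mul_of_nonneg_right hlσ
      (mul_nonneg hl.le (sq_nonneg ‖g (x t ω) - fstar (x t ω)‖))]

/-- Maximal inequality for the noise process over a finite family of bounded functions. -/
lemma exists_increment_bound (M : TimeSeriesModel μ 𝓕 T fstar σw x w y) {ι : Type*} {C : Finset ι}
    (hC : C.Nonempty) {h : ι → X → Euc dy} (hm : ∀ i ∈ C, Measurable (h i)) {r l L : ℝ}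
    (hr : ∀ i ∈ C, ∀ z, ‖h i z‖ ≤ r) (hl : 0 < l) (hL : Real.log C.card ≤ L) :
    ∃ Y : Ω → ℝ, Integrable Y μ ∧ ∫ ω, Y ω ∂μ ≤ (L + T * (σw ^ 2 * (l * r) ^ 2 / 2)) / l ∧
      ∀ ω, ∀ i ∈ C, ∑ t ∈ Finset.range T, inner ℝ (w t ω) (h i (x t ω)) ≤ Y ω := by
  refine exists_integrable_bound_of_exp_moment hC
    (Z := fun i ω => ∑ t ∈ Finset.range T, inner ℝ (w t ω) (h i (x t ω)))
    (fun i hi => M.measurable_sum_inner (hm i hi)) hl hL fun i hi => ?_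
  set b : ℝ := T * (σw ^ 2 * (l * r) ^ 2 / 2)
  have h1 := M.lintegral_exp_noise_le_one ((hm i hi).const_smul l)
  calc _ ≤ ∫⁻ ω, ENNReal.ofReal (Real.exp b) * ENNReal.ofReal (Real.exp (∑ t ∈ Finset.range T,
          (inner ℝ (w t ω) ((l • h i) (x t ω)) - σw ^ 2 * ‖(l • h i) (x t ω)‖ ^ 2 / 2))) ∂μ := by
        refine lintegral_mono fun ω => ?_
        rw [← ENNReal.ofReal_mul (Real.exp_nonneg _), ← Real.exp_add]
        refine ENNReal.ofReal_le_ofReal (Real.exp_le_exp.2 ?_)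
        have hb : b = ∑ t ∈ Finset.range T, (σw ^ 2 * (l * r) ^ 2 / 2 : ℝ) := by simp [b]
        rw [hb, ← Finset.sum_add_distrib, Finset.mul_sum]
        refine Finset.sum_le_sum fun t _ => ?_
        rw [Pi.smul_apply, inner_smul_right, norm_smul, Real.norm_of_nonneg hl.le]
        have : (l * ‖h i (x t ω)‖) ^ 2 ≤ (l * r) ^ 2 := by
          have := hr i hi (x t ω)
          gcongr
        nlinarith [mul_le_mul_of_nonneg_left this (sq_nonneg (σw : ℝ))]
    _ ≤ ENNReal.ofReal (Real.exp b) * 1 := by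
        rw [lintegral_const_mul' _ _ ENNReal.ofReal_ne_top]
        gcongr
    _ = _ := mul_one _

/-- Chaining through nets at the scales `γ / 2 ^ k`. -/
lemma exists_chaining_bound (M : TimeSeriesModel μ 𝓕 T fstar σw x w y) {γ : ℝ}
    (hFm : ∀ f ∈ F, Measurable f) {C : ℕ → Finset (X → Euc dy)} (hC : ∀ k, (C k).Nonempty)
    (hCF : ∀ k, ∀ g ∈ C k, g ∈ F)
    (hcov : ∀ k, ∀ f ∈ F, ∃ g ∈ C k, ∀ z, ‖f z - g z‖ ≤ γ / 2 ^ k) {B : ℕ → ℝ}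
    (hB : ∀ k, ∃ l L : ℝ, 0 < l ∧ Real.log (C (k + 1)).card ≤ L ∧
      (L + T * (σw ^ 2 * (l * (γ / 2 ^ k)) ^ 2 / 2)) / l ≤ B k) (n : ℕ) :
    ∃ Y : Ω → ℝ, Integrable Y μ ∧ ∫ ω, Y ω ∂μ ≤ ∑ k ∈ Finset.range n, B k ∧
      ∀ ω, ∀ f ∈ C n, ∃ g ∈ C 0, (∀ z, ‖f z - g z‖ ≤ 2 * γ - 2 * (γ / 2 ^ n)) ∧
        ∑ t ∈ Finset.range T, inner ℝ (w t ω) (f (x t ω))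
          ≤ ∑ t ∈ Finset.range T, inner ℝ (w t ω) (g (x t ω)) + Y ω := by
  induction n with
  | zero =>
    exact ⟨0, integrable_zero _ _ _, by simp, fun ω f hf => ⟨f, hf, by simp, by simp⟩⟩
  | succ n ih =>
    obtain ⟨Y, hY, hYi, hYb⟩ := ih
    obtain ⟨l, L, hl, hL, hBn⟩ := hB n
    -- The increments `f - π f` are indexed by `C (n + 1)` alone, so one level costs one entropy;
    -- their radii `γ / 2 ^ k` sum to `2γ - 2γ / 2 ^ n`.
    choose π hπC hπ using fun f : C (n + 1) => hcov n f (hCF _ _ f.2)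
    obtain ⟨Z, hZ, hZi, hZb⟩ := M.exists_increment_bound (C := (C (n + 1)).attach)
      (h := fun f z => f.1 z - π f z) (r := γ / 2 ^ n) (L := L) (l := l)
      (Finset.attach_nonempty_iff.2 (hC _))
      (fun f _ => (hFm _ (hCF _ _ f.2)).sub (hFm _ (hCF _ _ (hπC f)))) (fun f _ => hπ f) hl
      (by rwa [Finset.card_attach])
    refine ⟨Y + Z, hY.add hZ, ?_, fun ω f hf => ?_⟩
    · rw [integral_add' hY hZ, Finset.sum_range_succ]
      linarith
    · obtain ⟨g, hg, hfg, hW⟩ := hYb ω (π ⟨f, hf⟩) (hπC _)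
      refine ⟨g, hg, fun z => ?_, ?_⟩
      · have h1 := norm_sub_le_norm_sub_add_norm_sub (f z) (π ⟨f, hf⟩ z) (g z)
        have h2 := hπ ⟨f, hf⟩ z
        have h3 := hfg z
        have h4 : γ / 2 ^ n = 2 * (γ / 2 ^ (n + 1)) := by rw [pow_succ]; field_simp
        simp only at h2
        linarith
      · have h1 := hZb ω ⟨f, hf⟩ (Finset.mem_attach _ _)
        simp only [inner_sub_right, Finset.sum_sub_distrib, Pi.add_apply] at h1 ⊢
        linarith

end TimeSeriesModel

end LeastSquares

/-! ### Empirical squared error at a scale above the critical radius -/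

section EmpiricalError

lemma sum_pow_succ_half_rpow_le {q : ℝ} (hq0 : 0 ≤ q) (hq2 : q < 2) (n : ℕ) :
    ∑ k ∈ Finset.range n, ((1 / 2 : ℝ) ^ (1 - q / 2)) ^ (k + 1) ≤ 4 / (2 - q) := by
  set r : ℝ := (1 / 2 : ℝ) ^ (1 - q / 2) with hr
  have hr0 : 0 ≤ r := by positivity
  -- Bernoulli's inequality gives `1 - r ≥ (2 - q) / 4`, the source of the factor `1 / (2 - q)`.
  have hr1 : r ≤ 1 - (1 - q / 2) / 2 := by
    have := rpow_one_add_le_one_add_mul_self (s := -(1 / 2)) (p := 1 - q / 2) (by norm_num)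
      (by linarith) (by linarith)
    rw [show (1 : ℝ) + -(1 / 2) = 1 / 2 by norm_num] at this
    linarith
  have hgeom := geom_sum_mul_neg r n
  have hS : 0 ≤ ∑ k ∈ Finset.range n, r ^ k := Finset.sum_nonneg fun k _ => by positivity
  have hpow : 0 ≤ r ^ n := by positivity
  simp_rw [pow_succ, ← Finset.sum_mul]
  rw [le_div_iff₀ (by linarith)]
  nlinarith [mul_nonneg hS hr0]

variable {Ω : Type*} {mΩ : MeasurableSpace Ω} {μ : Measure Ω} [IsProbabilityMeasure μ]
  {𝓕 : Filtration ℕ mΩ} {dx dy : ℕ} {X : Set (Euc dx)} {F : Set (X → Euc dy)}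
  {fstar : X → Euc dy} {σw : ℝ≥0} {T : ℕ} {x : ℕ → Ω → X} {w y : ℕ → Ω → Euc dy}

/-- Localized empirical error bound for least squares at a scale `γ` above the critical radius. -/
lemma TimeSeriesModel.exists_empirical_error_bound (M : TimeSeriesModel μ 𝓕 T fstar σw x w y)
    (hT : 1 ≤ T) (hFm : ∀ f ∈ F, Measurable f) (hstar : fstar ∈ F) {K A p q γ : ℝ} (hK : 0 ≤ K)
    (hA : 1 ≤ A) (hp : 0 < p) (hq0 : 0 ≤ q) (hq2 : q < 2) (hγ : 0 < γ)
    (hent : ∀ δ : ℝ≥0, 0 < δ → (δ : ℝ) ≤ γ →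
      metricEntropy F δ ≤ ((K * (p * (1 / (δ : ℝ)) ^ q) : ℝ) : EReal))
    (hcrit : p * σw ^ 2 * (1 / γ) ^ q ≤ T * A * γ ^ 2) :
    ∃ Y : Ω → ℝ, Integrable Y μ ∧
      ∫ ω, Y ω ∂μ ≤ (16 * K + 32 * A + 32 * K * A + 10) * (γ ^ 2 / (2 - q)) ∧
      ∀ ω f, IsLeastSquares F T (fun t => x t ω) (fun t => y t ω) f →
        (1 / (T : ℝ)) * ∑ t ∈ Finset.range T, ‖f (x t ω) - fstar (x t ω)‖ ^ 2 ≤ Y ω := by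
  have hT0 : (0 : ℝ) < T := by exact_mod_cast hT
  have hnet : ∀ k : ℕ, ∃ C : Finset (X → Euc dy), C.Nonempty ∧ (∀ g ∈ C, g ∈ F) ∧
      Real.log C.card ≤ K * (p * (2 ^ k / γ) ^ q) ∧
      ∀ f ∈ F, ∃ g ∈ C, ∀ z, ‖f z - g z‖ ≤ γ / 2 ^ k := by
    intro k
    have hpos : 0 < γ / 2 ^ k := by positivity
    have h := exists_finset_cover_of_metricEntropy_le ⟨fstar, hstar⟩
      (hent (⟨γ / 2 ^ k, hpos.le⟩ : ℝ≥0) (by exact_mod_cast hpos)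
        (div_le_self hγ.le (one_le_pow₀ one_le_two)))
    rw [← one_div_div]
    exact h
  choose C hC hCF hCL hcov using hnet
  set r : ℝ := (1 / 2 : ℝ) ^ (1 - q / 2) with hr
  have hr0 : 0 < r := by positivity
  have hr2 : r ^ 2 * 4 = 2 ^ q := by
    rw [hr, ← Real.rpow_natCast, ← Real.rpow_mul (by norm_num), one_div, Real.inv_rpow (by norm_num),
      ← Real.rpow_neg (by norm_num), show (4 : ℝ) = 2 ^ (2 : ℝ) by norm_num,
      ← Real.rpow_add (by norm_num)]
    congr 1
    push_cast
    ring
  -- offset term at the coarsest scale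
  set E : ℝ := (1 / γ) ^ q with hE
  have hE0 : 0 < E := by positivity
  -- With this rate, `16 * l * σw ^ 2 ≤ 1` is exactly `hcrit`.
  obtain ⟨Y₀, hY₀, hY₀i, hY₀b⟩ := M.exists_offset_bound (hC 0) (fun g hg => hFm g (hCF 0 g hg))
    (hFm _ hstar) (l := p * E / (16 * T * A * γ ^ 2)) (by positivity) (by
      rw [← mul_div_assoc, div_mul_eq_mul_div, div_le_one (by positivity)]
      linarith) (hCL 0)
  have hY₀i' : ∫ ω, Y₀ ω ∂μ ≤ T * (16 * K * A * γ ^ 2) := by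
    refine hY₀i.trans_eq ?_
    rw [pow_zero, ← hE]
    field_simp
  -- increments
  obtain ⟨W, hW⟩ : ∃ W : ℝ, W = ∫ ω, ∑ t ∈ Finset.range T, ‖w t ω‖ ∂μ := ⟨_, rfl⟩
  have hwint : Integrable (fun ω => ∑ t ∈ Finset.range T, ‖w t ω‖) μ :=
    integrable_finsetSum _ fun t ht => (M.noise_subgaussian t (Finset.mem_range.1 ht)).1.norm
  -- The chain stops at a finite depth where Cauchy–Schwarz leaves a remainder of mean at most `T
  -- γ²`.
  obtain ⟨n, hn⟩ := pow_unbounded_of_one_lt (4 * W / (T * γ)) one_lt_two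
  obtain ⟨Y, hY, hYi, hYb⟩ := M.exists_chaining_bound hFm hC hCF hcov
    (B := fun k => T * (K + 2 * A) * γ ^ 2 * r ^ (k + 1)) (fun k => by
      set δ : ℝ := γ / 2 ^ (k + 1) with hδ
      set β : ℝ := γ ^ 2 * r ^ (k + 1) with hβ
      have hδ2 : γ / 2 ^ k = 2 * δ := by rw [hδ, pow_succ]; field_simp
      have hβ0 : 0 < β := by positivity
      have hEk : (2 ^ (k + 1) / γ) ^ q = E * (2 ^ q) ^ (k + 1) := by
        rw [div_eq_mul_one_div, Real.mul_rpow (by positivity) (by positivity), ← hE, mul_comm,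
          ← Real.rpow_natCast, ← Real.rpow_mul (by norm_num), ← Real.rpow_natCast,
          ← Real.rpow_mul (by norm_num), mul_comm q]
      set D : ℝ := (2 ^ (k + 1) / γ) ^ q with hD
      have hD0 : 0 < D := by positivity
      have hkey : p * σw ^ 2 * (D * δ ^ 2) ≤ T * A * β ^ 2 := by
        have h1 : D * δ ^ 2 = E * γ ^ 2 * (r ^ (k + 1)) ^ 2 := by
          rw [hEk, ← hr2, hδ, mul_pow, div_pow, show (4 : ℝ) = 2 ^ 2 by norm_num, ← pow_mul,
            ← pow_mul, ← pow_mul, ← pow_mul]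
          rw [mul_comm (k + 1) 2]
          field_simp
        rw [h1, hβ]
        nlinarith [mul_le_mul_of_nonneg_right hcrit
          (by positivity : 0 ≤ γ ^ 2 * (r ^ (k + 1)) ^ 2)]
      -- Per level, entropy grows by `2^q` and squared radius shrinks by `4`, so `D δ²` scales by
      -- `r²`. This rate makes the entropy term `K T β` and the variance term at most `2 A T β`.
      refine ⟨p * D / (T * β), K * (p * D), by positivity, hCL (k + 1), ?_⟩
      rw [hδ2]
      have h2 : (K * (p * D) + T * (σw ^ 2 * (p * D / (T * β) * (2 * δ)) ^ 2 / 2))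
          / (p * D / (T * β)) = K * T * β + 2 * (p * σw ^ 2 * (D * δ ^ 2)) / β := by
        field_simp
      have h3 : 2 * (p * σw ^ 2 * (D * δ ^ 2)) / β ≤ 2 * T * A * β := by
        rw [div_le_iff₀ hβ0]
        nlinarith
      rw [h2]
      calc _ ≤ K * T * β + 2 * T * A * β := by linarith
        _ = _ := by rw [hβ]; ring) n
  refine ⟨fun ω => (1 / (T : ℝ)) * (4 * (γ / 2 ^ n) * (∑ t ∈ Finset.range T, ‖w t ω‖) + 4 * Y ω
    + Y₀ ω + 4 * T * γ ^ 2), ?_, ?_, fun ω f hf => ?_⟩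
  · exact ((((hwint.const_mul _).add (hY.const_mul _)).add hY₀).add
      (integrable_const _)).const_mul _
  · have i1 : Integrable (fun ω => 4 * (γ / 2 ^ n) * (∑ t ∈ Finset.range T, ‖w t ω‖)) μ :=
      hwint.const_mul _
    have i2 : Integrable (fun ω => 4 * Y ω) μ := hY.const_mul _
    have i3 : Integrable (fun ω => 4 * (γ / 2 ^ n) * (∑ t ∈ Finset.range T, ‖w t ω‖) + 4 * Y ω) μ :=
      i1.add i2
    have i4 : Integrable (fun ω => 4 * (γ / 2 ^ n) * (∑ t ∈ Finset.range T, ‖w t ω‖) + 4 * Y ω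
      + Y₀ ω) μ := i3.add hY₀
    rw [integral_const_mul, integral_add i4 (integrable_const _), integral_add i3 hY₀,
      integral_add i1 i2, integral_const_mul, integral_const_mul, ← hW]
    simp only [integral_const, probReal_univ, smul_eq_mul, one_mul]
    have h1 : 4 * (γ / 2 ^ n) * W ≤ T * γ ^ 2 := by
      rw [div_lt_iff₀ (by positivity)] at hn
      rw [mul_div_assoc', div_mul_eq_mul_div, div_le_iff₀ (by positivity)]
      nlinarith
    have h2 : ∫ ω, Y ω ∂μ ≤ T * ((K + 2 * A) * γ ^ 2 * (4 / (2 - q))) := by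
      rw [← Finset.mul_sum] at hYi
      refine hYi.trans ?_
      calc _ ≤ T * (K + 2 * A) * γ ^ 2 * (4 / (2 - q)) := by
            gcongr
            exact sum_pow_succ_half_rpow_le hq0 hq2 n
        _ = _ := by ring
    have h3 : γ ^ 2 ≤ 2 * (γ ^ 2 / (2 - q)) := by
      rw [← mul_div_assoc, le_div_iff₀ (by linarith)]
      nlinarith [sq_nonneg γ]
    have h4 : (16 * K * A + 5) * γ ^ 2 ≤ (16 * K * A + 5) * (2 * (γ ^ 2 / (2 - q))) :=
      mul_le_mul_of_nonneg_left h3 (by positivity)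
    rw [one_div, inv_mul_le_iff₀ hT0]
    calc _ ≤ T * γ ^ 2 + 4 * (T * ((K + 2 * A) * γ ^ 2 * (4 / (2 - q))))
          + T * (16 * K * A * γ ^ 2) + 4 * T * γ ^ 2 := by linarith
      _ = T * (16 * (K + 2 * A) * (γ ^ 2 / (2 - q)) + (16 * K * A + 5) * γ ^ 2) := by ring
      _ ≤ T * (16 * (K + 2 * A) * (γ ^ 2 / (2 - q))
            + (16 * K * A + 5) * (2 * (γ ^ 2 / (2 - q)))) := by gcongr
      _ = _ := by ring
  · refine mul_le_mul_of_nonneg_left ?_ (by positivity)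
    obtain ⟨f', hf', hff'⟩ := hcov n f hf.1
    obtain ⟨g, hg, hfg, hWg⟩ := hYb ω f' hf'
    have h0 := hY₀b ω g hg
    have hD := M.sum_norm_sq_le hT hstar hf
    have hdist : ∀ z, ‖f z - g z‖ ≤ 2 * γ := fun z => by
      have h1 := norm_sub_le_norm_sub_add_norm_sub (f z) (f' z) (g z)
      have h2 := hff' z
      have h3 := hfg z
      have : 0 < γ / 2 ^ n := by positivity
      linarith
    have hoff : ∑ t ∈ Finset.range T, ‖g (x t ω) - fstar (x t ω)‖ ^ 2
        ≤ 2 * ∑ t ∈ Finset.range T, ‖f (x t ω) - fstar (x t ω)‖ ^ 2 + T * (8 * γ ^ 2) := by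
      have hc : (T : ℝ) * (8 * γ ^ 2) = ∑ t ∈ Finset.range T, 8 * γ ^ 2 := by simp
      rw [hc, Finset.mul_sum, ← Finset.sum_add_distrib]
      refine Finset.sum_le_sum fun t _ => ?_
      have h1 := norm_sub_le_norm_sub_add_norm_sub (g (x t ω)) (f (x t ω)) (fstar (x t ω))
      have h2 := hdist (x t ω)
      rw [norm_sub_rev] at h2
      have h3 : ‖g (x t ω) - fstar (x t ω)‖ ≤ 2 * γ + ‖f (x t ω) - fstar (x t ω)‖ := by linarith
      have h4 := pow_le_pow_left₀ (norm_nonneg _) h3 2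
      nlinarith [sq_nonneg (2 * γ - ‖f (x t ω) - fstar (x t ω)‖)]
    have htail : ∑ t ∈ Finset.range T, inner ℝ (w t ω) (f (x t ω) - f' (x t ω))
        ≤ (γ / 2 ^ n) * ∑ t ∈ Finset.range T, ‖w t ω‖ := by
      rw [Finset.mul_sum]
      refine Finset.sum_le_sum fun t _ => ?_
      calc _ ≤ ‖w t ω‖ * ‖f (x t ω) - f' (x t ω)‖ := real_inner_le_norm _ _
        _ ≤ ‖w t ω‖ * (γ / 2 ^ n) := by gcongr; exact hff' _
        _ = _ := mul_comm _ _
    simp only [inner_sub_right, Finset.sum_sub_distrib] at hD htail h0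
    -- Here `f - f⋆` is split as `(f - f') + (f' - g) + (g - f⋆)`: tail, chain, offset. By `hoff`,
    -- `-D` is at most minus half the sum of squares at `g`, plus `4 T γ²`.
    linarith

end EmpiricalError

/-! ### From empirical to population error -/

section Population

variable {Ω : Type*} {mΩ : MeasurableSpace Ω} {μ : Measure Ω}
  {𝓕 : Filtration ℕ mΩ} {dx dy : ℕ} {X : Set (Euc dx)} {F : Set (X → Euc dy)}
  {fstar : X → Euc dy} {σw : ℝ≥0} {T : ℕ} {x : ℕ → Ω → X} {w y : ℕ → Ω → Euc dy}

/-- The empirical `L¹` distance of two functions along the sampled covariates. -/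
noncomputable def empDist (T : ℕ) (x : ℕ → Ω → X) (f g : X → Euc dy) (ω : Ω) : ℝ :=
  (1 / (T : ℝ)) * ∑ t ∈ Finset.range T, ‖f (x t ω) - g (x t ω)‖

lemma avgDist_trajectory (f g : X → Euc dy) (ω : Ω) :
    avgDist f g (fun t : Fin T => x t ω, fun t : Fin T => y t ω) = empDist T x f g ω := by
  rw [avgDist, empDist, Finset.sum_range fun t => ‖f (x t ω) - g (x t ω)‖]

lemma measurable_avgDist {f g : X → Euc dy} (hf : Measurable f) (hg : Measurable g) :
    Measurable (avgDist (T := T) f g) := by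
  unfold avgDist
  fun_prop

lemma empDist_nonneg (f g : X → Euc dy) (ω : Ω) : 0 ≤ empDist T x f g ω := by
  unfold empDist
  positivity

lemma empDist_le_of_norm_sub_le (hT : 1 ≤ T) {f g h : X → Euc dy} {δ : ℝ}
    (hfg : ∀ z, ‖f z - g z‖ ≤ δ) (ω : Ω) : empDist T x f h ω ≤ δ + empDist T x g h ω := by
  have hT0 : (0 : ℝ) < T := by exact_mod_cast hT
  have hδ : δ = (1 / (T : ℝ)) * ∑ t ∈ Finset.range T, δ := by
    rw [Finset.sum_const, Finset.card_range, nsmul_eq_mul]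
    field_simp
  rw [hδ, empDist, empDist, ← mul_add, ← Finset.sum_add_distrib]
  refine mul_le_mul_of_nonneg_left (Finset.sum_le_sum fun t _ => ?_) (by positivity)
  exact (norm_sub_le_norm_sub_add_norm_sub _ (g (x t ω)) _).trans
    (add_le_add_left (hfg _) _)

/-- AM–GM with a deterministic `a` is linear in the squared error, so expectations pass through
without Jensen's inequality. -/
lemma empDist_le_of_sq (hT : 1 ≤ T) (f g : X → Euc dy) (ω : Ω) {a : ℝ} (ha : 0 < a) :
    empDist T x f g ω
      ≤ ((1 / (T : ℝ)) * (∑ t ∈ Finset.range T, ‖f (x t ω) - g (x t ω)‖ ^ 2) / a + a) / 2 := by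
  have hT0 : (0 : ℝ) < T := by exact_mod_cast hT
  have h : ∑ t ∈ Finset.range T, ‖f (x t ω) - g (x t ω)‖
      ≤ ∑ t ∈ Finset.range T, (‖f (x t ω) - g (x t ω)‖ ^ 2 / a + a) / 2 := by
    refine Finset.sum_le_sum fun t _ => ?_
    rw [le_div_iff₀ two_pos, div_add' _ _ _ ha.ne', le_div_iff₀ ha]
    nlinarith [sq_nonneg (‖f (x t ω) - g (x t ω)‖ - a)]
  rw [← Finset.sum_div, Finset.sum_add_distrib, ← Finset.sum_div, Finset.sum_const,
    Finset.card_range, nsmul_eq_mul] at h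
  calc _ ≤ (1 / (T : ℝ)) * (((∑ t ∈ Finset.range T, ‖f (x t ω) - g (x t ω)‖ ^ 2) / a
        + T * a) / 2) := mul_le_mul_of_nonneg_left h (by positivity)
    _ = _ := by field_simp

namespace TimeSeriesModel

lemma measurable_empDist (M : TimeSeriesModel μ 𝓕 T fstar σw x w y) {f g : X → Euc dy}
    (hf : Measurable f) (hg : Measurable g) : Measurable (empDist T x f g) := by
  refine (Finset.measurable_sum _ fun t ht => ?_).const_mul _
  exact ((hf.sub hg).comp (M.measurable_x (Finset.mem_range.1 ht))).norm

lemma integrable_norm_sub [IsProbabilityMeasure μ] (M : TimeSeriesModel μ 𝓕 T fstar σw x w y)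
    (hF : FiniteSupDist F) {f g : X → Euc dy} (hf : f ∈ F) (hg : g ∈ F) (hfm : Measurable f)
    (hgm : Measurable g) {t : ℕ} (ht : t < T) :
    Integrable (fun ω => ‖f (x t ω) - g (x t ω)‖) μ := by
  obtain ⟨B, -, hB⟩ := hF.exists_bound hf hg
  refine Integrable.of_bound (C := B) ?_ (Filter.Eventually.of_forall fun ω => ?_)
  · exact ((hfm.sub hgm).comp (M.measurable_x ht)).norm.aestronglyMeasurable
  · rw [norm_norm]
    exact hB _

lemma integrable_empDist [IsProbabilityMeasure μ] (M : TimeSeriesModel μ 𝓕 T fstar σw x w y)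
    (hF : FiniteSupDist F) {f g : X → Euc dy} (hf : f ∈ F) (hg : g ∈ F) (hfm : Measurable f)
    (hgm : Measurable g) : Integrable (empDist T x f g) μ :=
  (integrable_finsetSum _ fun _ ht =>
    M.integrable_norm_sub hF hf hg hfm hgm (Finset.mem_range.1 ht)).const_mul _

lemma measurable_trajectory (M : TimeSeriesModel μ 𝓕 T fstar σw x w y) (hs : Measurable fstar) :
    Measurable fun ω => (fun t : Fin T => x t ω, fun t : Fin T => y t ω) := by
  refine Measurable.prodMk (measurable_pi_lambda _ fun t => M.measurable_x t.2)
    (measurable_pi_lambda _ fun t => ?_)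
  have h : y t = fun ω => fstar (x t ω) + w t ω := funext (M.output_eq t t.2)
  change Measurable (y t)
  rw [h]
  exact (hs.comp (M.measurable_x t.2)).add (M.measurable_w t.2)

/-- The infimum in the variance proxy is attained. -/
lemma lintegral_exp_empDist_le [IsProbabilityMeasure μ] (M : TimeSeriesModel μ 𝓕 T fstar σw x w y)
    (hs : Measurable fstar) (hV : varianceProxy F (trajectoryLaw μ T x y) ≠ ⊤)
    {f g : X → Euc dy} (hf : f ∈ F) (hg : g ∈ F) (hfm : Measurable f) (hgm : Measurable g)
    (l : ℝ) :
    ∫⁻ ω, ENNReal.ofReal (Real.exp (l * (∫ ω', empDist T x f g ω' ∂μ - empDist T x f g ω))) ∂μ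
      ≤ ENNReal.ofReal (Real.exp
          ((varianceProxy F (trajectoryLaw μ T x y)).toReal * l ^ 2 / 2)) := by
  set V := varianceProxy F (trajectoryLaw μ T x y) with hVdef
  have htr := M.measurable_trajectory hs
  have hmean : ∫ z, avgDist f g z ∂(trajectoryLaw μ T x y) = ∫ ω, empDist T x f g ω ∂μ := by
    rw [trajectoryLaw, integral_map htr.aemeasurable
      (measurable_avgDist hfm hgm).aestronglyMeasurable]
    simp_rw [avgDist_trajectory]
  set m := ∫ ω, empDist T x f g ω ∂μ
  -- Every `v` above the infimum exceeds an admissible proxy; continuity in `v` then gives the bound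
  -- at the infimum.
  have hlt : ∀ v : ℝ, V.toReal < v →
      ∫⁻ ω, ENNReal.ofReal (Real.exp (l * (m - empDist T x f g ω))) ∂μ
        ≤ ENNReal.ofReal (Real.exp (v * l ^ 2 / 2)) := by
    intro v hv
    have hv' : V < ENNReal.ofReal v := (ENNReal.lt_ofReal_iff_toReal_lt hV).2 hv
    rw [hVdef, varianceProxy] at hv'
    simp only [iInf_lt_iff] at hv'
    obtain ⟨c, hc, hcv⟩ := hv'
    have hsub := HasSubgaussianMGF.of_map htr.aemeasurable (hc f hf g hg)
    rw [hmean] at hsub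
    have hcomp : ((fun z => avgDist f g z - m) ∘
        fun ω => ((fun t : Fin T => x t ω, fun t : Fin T => y t ω) :
          (Fin T → X) × (Fin T → Euc dy))) = fun ω => empDist T x f g ω - m :=
      funext fun ω => by rw [Function.comp_apply, avgDist_trajectory]
    rw [hcomp] at hsub
    have h1 := hsub.mgf_le (-l)
    have h2 := hsub.integrable_exp_mul (-l)
    have hc' : (c : ℝ) ≤ v := by
      rw [← ENNReal.ofReal_coe_nnreal] at hcv
      exact (ENNReal.ofReal_lt_ofReal_iff'.1 hcv).1.le
    calc _ = ∫⁻ ω, ENNReal.ofReal (Real.exp (-l * (empDist T x f g ω - m))) ∂μ := by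
          refine lintegral_congr fun ω => ?_
          congr 2
          ring
      _ = ENNReal.ofReal (mgf (fun ω => empDist T x f g ω - m) μ (-l)) := by
          rw [mgf, ofReal_integral_eq_lintegral_ofReal h2
            (Filter.Eventually.of_forall fun ω => Real.exp_nonneg _)]
      _ ≤ _ := by
          refine ENNReal.ofReal_le_ofReal (h1.trans (Real.exp_le_exp.2 ?_))
          rw [neg_sq]
          gcongr
  have hcont : Continuous fun v : ℝ => ENNReal.ofReal (Real.exp (v * l ^ 2 / 2)) :=
    ENNReal.continuous_ofReal.comp (by fun_prop)
  exact ge_of_tendsto ((hcont.tendsto V.toReal).mono_left nhdsWithin_le_nhds)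
    (Filter.eventually_of_mem (U := Set.Ioi V.toReal) self_mem_nhdsWithin hlt)

/-- One-sided uniform deviation between the empirical `L¹` distance and its expectation. -/
lemma exists_deviation_bound [IsProbabilityMeasure μ] (M : TimeSeriesModel μ 𝓕 T fstar σw x w y)
    (hT : 1 ≤ T) (hF : FiniteSupDist F) (hFm : ∀ f ∈ F, Measurable f) (hstar : fstar ∈ F)
    (hV : varianceProxy F (trajectoryLaw μ T x y) ≠ ⊤) {K A p q : ℝ} {δ : ℝ≥0}
    (hp : 0 < p) (hδ : 0 < δ)
    (hent : metricEntropy F δ ≤ ((K * (p * (1 / (δ : ℝ)) ^ q) : ℝ) : EReal))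
    (hcrit : p * (varianceProxy F (trajectoryLaw μ T x y)).toReal * (1 / δ) ^ q ≤ A * δ ^ 2) :
    ∃ Y : Ω → ℝ, Integrable Y μ ∧ ∫ ω, Y ω ∂μ ≤ (K + A + 2) * δ ∧
      ∀ ω, ∀ f ∈ F, ∫ ω', empDist T x f fstar ω' ∂μ ≤ empDist T x f fstar ω + Y ω := by
  set V := (varianceProxy F (trajectoryLaw μ T x y)).toReal with hVdef
  have hδ0 : (0 : ℝ) < δ := hδ
  set D : ℝ := (1 / (δ : ℝ)) ^ q with hD
  have hD0 : 0 < D := by positivity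
  obtain ⟨C, hC, hCF, hCL, hcov⟩ := exists_finset_cover_of_metricEntropy_le ⟨fstar, hstar⟩ hent
  -- At this rate the entropy costs `K δ` and the variance term at most `A δ`, by `hcrit`.
  have hl : 0 < p * D / δ := by positivity
  obtain ⟨Y, hY, hYi, hYb⟩ := exists_integrable_bound_of_exp_moment (μ := μ) hC
    (Z := fun g ω => ∫ ω', empDist T x g fstar ω' ∂μ - empDist T x g fstar ω)
    (fun g hg => (M.measurable_empDist (hFm g (hCF g hg)) (hFm _ hstar)).const_sub _) hl hCL
    (fun g hg => M.lintegral_exp_empDist_le (hFm _ hstar) hV (hCF g hg) hstar (hFm g (hCF g hg))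
      (hFm _ hstar) (p * D / δ))
  -- One `δ` pays for replacing `f` by its net point in the mean, the other in the empirical
  -- distance.
  refine ⟨fun ω => 2 * δ + Y ω, (integrable_const _).add hY, ?_, fun ω f hf => ?_⟩
  · rw [integral_add (integrable_const _) hY]
    simp only [integral_const, probReal_univ, smul_eq_mul, one_mul]
    have h1 : (K * (p * D) + V * (p * D / δ) ^ 2 / 2) / (p * D / δ)
        = K * δ + (p * V * D) / (2 * δ) := by
      field_simp
    have h2 : (p * V * D) / (2 * δ) ≤ A * δ := by
      rw [div_le_iff₀ (by positivity)]
      have : 0 ≤ p * V * D := by positivity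
      nlinarith
    rw [← hVdef, h1] at hYi
    linarith
  · obtain ⟨g, hg, hfg⟩ := hcov f hf
    have hgF := hCF g hg
    have h1 : ∫ ω', empDist T x f fstar ω' ∂μ ≤ δ + ∫ ω', empDist T x g fstar ω' ∂μ := by
      have hi := M.integrable_empDist hF hgF hstar (hFm g hgF) (hFm _ hstar)
      calc _ ≤ ∫ ω', (δ + empDist T x g fstar ω') ∂μ :=
            integral_mono (M.integrable_empDist hF hf hstar (hFm f hf) (hFm _ hstar))
              ((integrable_const _).add hi) fun ω' => empDist_le_of_norm_sub_le hT hfg ω'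
        _ = _ := by
            rw [integral_add (integrable_const _) hi]
            simp
    have h2 : empDist T x g fstar ω ≤ δ + empDist T x f fstar ω :=
      empDist_le_of_norm_sub_le hT (fun z => by rw [norm_sub_rev]; exact hfg z) ω
    have h3 := hYb ω g hg
    linarith

lemma lintegral_mixtureLaw_eq [IsProbabilityMeasure μ]
    (M : TimeSeriesModel μ 𝓕 T fstar σw x w y) (hT : 1 ≤ T) (hF : FiniteSupDist F)
    {f g : X → Euc dy} (hf : f ∈ F) (hg : g ∈ F) (hfm : Measurable f) (hgm : Measurable g) :
    ∫⁻ z, ‖f z - g z‖ₑ ∂(mixtureLaw μ T x) = ENNReal.ofReal (∫ ω, empDist T x f g ω ∂μ) := by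
  have hT0 : (0 : ℝ) < T := by exact_mod_cast hT
  have hint : ∀ t ∈ Finset.range T, Integrable (fun ω => ‖f (x t ω) - g (x t ω)‖) μ :=
    fun t ht => M.integrable_norm_sub hF hf hg hfm hgm (Finset.mem_range.1 ht)
  have hm : Measurable fun z => ‖f z - g z‖ₑ := (hfm.sub hgm).enorm
  simp only [empDist]
  rw [mixtureLaw, lintegral_smul_measure, lintegral_finsetSum_measure, integral_const_mul,
    integral_finsetSum _ hint, ENNReal.ofReal_mul (by positivity),
    ENNReal.ofReal_sum_of_nonneg fun t _ => integral_nonneg fun ω => norm_nonneg _, smul_eq_mul,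
    one_div, ENNReal.ofReal_inv_of_pos hT0, ENNReal.ofReal_natCast]
  congr 1
  refine Finset.sum_congr rfl fun t ht => ?_
  rw [lintegral_map hm (M.measurable_x (Finset.mem_range.1 ht)),
    ofReal_integral_eq_lintegral_ofReal (hint t ht)
      (Filter.Eventually.of_forall fun ω => norm_nonneg _)]
  simp_rw [ofReal_norm]

/-- The error bound for least squares at scales above the two critical radii. -/
lemma expectedError_le [IsProbabilityMeasure μ] (M : TimeSeriesModel μ 𝓕 T fstar σw x w y)
    (hT : 1 ≤ T) (hF : FiniteSupDist F) (hFm : ∀ f ∈ F, Measurable f) (hstar : fstar ∈ F)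
    (hV : varianceProxy F (trajectoryLaw μ T x y) ≠ ⊤) {fhat : Ω → X → Euc dy}
    (hfm : Measurable fun z : Ω × X => fhat z.1 z.2)
    (hls : ∀ᵐ ω ∂μ, IsLeastSquares F T (fun t => x t ω) (fun t => y t ω) (fhat ω))
    {K A p q γ δ : ℝ} (hK : 0 ≤ K) (hA : 1 ≤ A) (hp : 0 < p) (hq0 : 0 ≤ q) (hq2 : q < 2)
    (hγ : 0 < γ) (hδ : 0 < δ)
    (hent : ∀ ε : ℝ≥0, 0 < ε → (ε : ℝ) ≤ max γ δ →
      metricEntropy F ε ≤ ((K * (p * (1 / (ε : ℝ)) ^ q) : ℝ) : EReal))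
    (hγc : p * σw ^ 2 * (1 / γ) ^ q ≤ T * A * γ ^ 2)
    (hδc : p * (varianceProxy F (trajectoryLaw μ T x y)).toReal * (1 / δ) ^ q ≤ A * δ ^ 2) :
    expectedError μ T x fhat fstar ≤ ENNReal.ofReal ((16 * K + 32 * A + 32 * K * A + 11) *
      (Real.sqrt (1 / (2 - q)) * γ + δ)) := by
  obtain ⟨Y, hY, hYi, hYb⟩ := M.exists_empirical_error_bound hT hFm hstar hK hA hp hq0 hq2 hγ
    (fun ε h1 h2 => hent ε h1 (h2.trans (le_max_left _ _))) hγc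
  lift δ to ℝ≥0 using hδ.le
  obtain ⟨Z, hZ, hZi, hZb⟩ := M.exists_deviation_bound hT hF hFm hstar hV hp hδ
    (hent δ hδ (le_max_right _ _)) hδc
  have hs0 : 0 < Real.sqrt (1 / (2 - q)) := Real.sqrt_pos.2 (one_div_pos.2 (by linarith))
  -- Then `a²` is the order of the mean of `Y`, which balances the two AM–GM terms.
  set a : ℝ := Real.sqrt (1 / (2 - q)) * γ with ha
  have ha0 : 0 < a := by positivity
  have ha2 : γ ^ 2 / (2 - q) = a * a := by
    rw [ha, mul_mul_mul_comm, Real.mul_self_sqrt (one_div_nonneg.2 (by linarith))]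
    ring
  set Q : Ω → ℝ := fun ω => (Y ω / a + a) / 2 + Z ω with hQ
  have hQint : Integrable Q μ := (((hY.div_const _).add (integrable_const _)).div_const _).add hZ
  have hbound : ∀ᵐ ω ∂μ, 0 ≤ Q ω ∧
      ∫⁻ z, ‖fhat ω z - fstar z‖ₑ ∂(mixtureLaw μ T x) ≤ ENNReal.ofReal (Q ω) := by
    filter_upwards [hls] with ω hω
    have hle : ∫ ω', empDist T x (fhat ω) fstar ω' ∂μ ≤ Q ω := by
      refine (hZb ω _ hω.1).trans (add_le_add_left ?_ _)
      refine (empDist_le_of_sq hT _ _ ω ha0).trans ?_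
      have := hYb ω _ hω
      gcongr
    refine ⟨(integral_nonneg fun ω' => empDist_nonneg _ _ _).trans hle, ?_⟩
    rw [M.lintegral_mixtureLaw_eq hT hF hω.1 hstar (hFm _ hω.1) (hFm _ hstar)]
    exact ENNReal.ofReal_le_ofReal hle
  have hsf : SFinite (mixtureLaw μ T x) := by
    unfold mixtureLaw
    infer_instance
  have hmeas : Measurable fun z : Ω × X => ‖fhat z.1 z.2 - fstar z.2‖ₑ :=
    (hfm.sub ((hFm _ hstar).comp measurable_snd)).enorm
  rw [expectedError, lintegral_prod _ hmeas.aemeasurable]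
  calc _ ≤ ∫⁻ ω, ENNReal.ofReal (Q ω) ∂μ := lintegral_mono_ae (hbound.mono fun ω h => h.2)
    _ = ENNReal.ofReal (∫ ω, Q ω ∂μ) :=
        (ofReal_integral_eq_lintegral_ofReal hQint (hbound.mono fun ω h => h.1)).symm
    _ ≤ _ := by
        refine ENNReal.ofReal_le_ofReal ?_
        have i1 : Integrable (fun ω => Y ω / a) μ := hY.div_const _
        have i2 : Integrable (fun ω => Y ω / a + a) μ := i1.add (integrable_const _)
        have i3 : Integrable (fun ω => (Y ω / a + a) / 2) μ := i2.div_const _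
        rw [hQ, integral_add i3 hZ, integral_div, integral_add i1 (integrable_const _),
          integral_div]
        simp only [integral_const, probReal_univ, smul_eq_mul, one_mul]
        rw [ha2, ← mul_assoc, ← div_le_iff₀ ha0] at hYi
        have h1 : 0 ≤ K * A := by positivity
        have h2 : 0 ≤ K * a := by positivity
        have h3 : 0 ≤ A * a := by positivity
        have h4 : 0 ≤ K * A * a := by positivity
        have h5 : 0 ≤ K * δ := by positivity
        have h6 : 0 ≤ A * δ := by positivity
        have h7 : 0 ≤ K * A * δ := by positivity
        have h8 : (0 : ℝ) ≤ δ := δ.2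
        linarith

end TimeSeriesModel

end Population

/-! ### Choice of scales and degenerate cases -/

section Rates

/-- As `2 + q < 4` and `r ≥ 1`, the loss `r^(2+q)` is at most `r^4`, free of `q`. -/
lemma mul_one_div_rpow_le_of_le_rpow {a q r γ : ℝ} (hq2 : q < 2) (hr : 1 ≤ r)
    (hγ : 0 < γ) (h : a ≤ (r * γ) ^ (2 + q)) : a * (1 / γ) ^ q ≤ r ^ 4 * γ ^ 2 := by
  have hr0 : 0 < r := by linarith
  have h1 : r ^ (2 + q) ≤ r ^ 4 := by
    rw [← Real.rpow_natCast]
    exact Real.rpow_le_rpow_of_exponent_le hr (by push_cast; linarith)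
  have h2 : γ ^ (2 + q) * (1 / γ) ^ q = γ ^ 2 := by
    rw [one_div, Real.inv_rpow hγ.le, Real.rpow_add hγ, Real.rpow_two,
      mul_inv_cancel_right₀ (Real.rpow_pos_of_pos hγ q).ne']
  calc a * (1 / γ) ^ q ≤ (r * γ) ^ (2 + q) * (1 / γ) ^ q := by gcongr
    _ = r ^ (2 + q) * γ ^ 2 := by rw [Real.mul_rpow hr0.le hγ.le, mul_assoc, h2]
    _ ≤ r ^ 4 * γ ^ 2 := by gcongr

lemma le_mul_max_rpow {b q r ε : ℝ} (hb : 0 ≤ b) (hq0 : 0 ≤ q) (hr : 1 ≤ r) :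
    b ≤ (r * max (b ^ (1 / (2 + q)) / r) ε) ^ (2 + q) := by
  have hr0 : 0 < r := by linarith
  calc b = (b ^ (1 / (2 + q))) ^ (2 + q) := by
        rw [← Real.rpow_mul hb, one_div_mul_cancel (by linarith), Real.rpow_one]
    _ ≤ _ := by
        gcongr
        rw [← div_le_iff₀' hr0]
        exact le_max_left _ _

lemma ofReal_max_div_le {G r ε : ℝ} {R : ℝ≥0} {δ₀ : ℝ≥0∞} (hr : 0 < r) (hR : (R : ℝ) ≤ r)
    (hG : ENNReal.ofReal G ≤ R * δ₀) (hε : ENNReal.ofReal ε ≤ δ₀) :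
    ENNReal.ofReal (max (G / r) ε) ≤ δ₀ := by
  rw [ENNReal.ofReal_max]
  refine max_le ?_ hε
  rw [ENNReal.ofReal_div_of_pos hr]
  refine ENNReal.div_le_of_le_mul' (hG.trans ?_)
  gcongr
  rw [← ENNReal.ofReal_coe_nnreal]
  exact ENNReal.ofReal_le_ofReal hR

/-- The exponential rates need a positive `p`. If `p = 0`, the slack `c` leaves room for a small
positive substitute. -/
lemma exists_pos_ge_and_mul_le {p a b c : ℝ} (hp : 0 ≤ p) (ha : 0 ≤ a) (hb : 0 ≤ b) {A B : ℝ}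
    (hc : 0 < c) (hcA : c ≤ A) (hcB : c ≤ B) (hA : p * a ≤ A) (hB : p * b ≤ B) :
    ∃ p' : ℝ, 0 < p' ∧ p ≤ p' ∧ p' * a ≤ A ∧ p' * b ≤ B := by
  rcases hp.lt_or_eq with hp | rfl
  · exact ⟨p, hp, le_rfl, hA, hB⟩
  · refine ⟨c / (a + b + 1), by positivity, by positivity, ?_, ?_⟩
    · refine le_trans ?_ hcA
      rw [div_mul_eq_mul_div, div_le_iff₀ (by positivity)]
      nlinarith
    · refine le_trans ?_ hcB
      rw [div_mul_eq_mul_div, div_le_iff₀ (by positivity)]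
      nlinarith

end Rates

theorem theorem2 (K : ℝ) (R : ℝ≥0) :
    ∃ C : ℝ, 0 < C ∧
      ∀ (Ω : Type*) (mΩ : MeasurableSpace Ω) (μ : Measure Ω) (_ : IsProbabilityMeasure μ)
        (𝓕 : Filtration ℕ mΩ) (dx dy : ℕ) (X : Set (Euc dx)) (F : Set (X → Euc dy))
        (fstar : X → Euc dy) (σw : ℝ≥0) (T : ℕ)
        (x : ℕ → Ω → X) (w y : ℕ → Ω → Euc dy) (fhat : Ω → X → Euc dy)
        (p q : ℝ) (δ₀ : ℝ≥0∞),
        1 ≤ T →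
        FiniteSupDist F →
        (∀ f ∈ F, Measurable f) →
        fstar ∈ F →
        TimeSeriesModel μ 𝓕 T fstar σw x w y →
        varianceProxy F (trajectoryLaw μ T x y) ≠ ⊤ →
        Measurable (fun z : Ω × X => fhat z.1 z.2) →
        (∀ᵐ ω ∂μ, IsLeastSquares F T (fun t => x t ω) (fun t => y t ω) (fhat ω)) →
        0 ≤ p → 0 ≤ q → q < 2 →
        0 < δ₀ →
        (∀ δ : ℝ≥0, 0 < δ → (δ : ℝ≥0∞) ≤ δ₀ →
          metricEntropy F δ ≤ ((K * (p * (1 / (δ : ℝ)) ^ q) : ℝ) : EReal)) →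
        ENNReal.ofReal ((p * (σw : ℝ) ^ 2 / T) ^ (1 / (2 + q))) ≤ R * δ₀ →
        ENNReal.ofReal
          ((p * (varianceProxy F (trajectoryLaw μ T x y)).toReal) ^ (1 / (2 + q))) ≤ R * δ₀ →
        expectedError μ T x fhat fstar ≤
          ENNReal.ofReal (C *
            (Real.sqrt (1 / (2 - q)) * (p * (σw : ℝ) ^ 2 / T) ^ (1 / (2 + q))
              + (p * (varianceProxy F (trajectoryLaw μ T x y)).toReal) ^ (1 / (2 + q)))) := by
  set k : ℝ := max K 0 with hk
  set r : ℝ := max R 1 with hr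
  have hk0 : 0 ≤ k := le_max_right _ _
  have hr1 : 1 ≤ r := le_max_right _ _
  have hr0 : 0 < r := by linarith
  have hA : 1 ≤ r ^ 4 := one_le_pow₀ hr1
  set c : ℝ := 16 * k + 32 * r ^ 4 + 32 * k * r ^ 4 + 11 with hc
  have hc0 : 0 < c := by positivity
  refine ⟨c, hc0, ?_⟩
  intro Ω mΩ μ _ 𝓕 dx dy X F fstar σw T x w y fhat p q δ₀ hT hF hFm hstar M hV hfm hls hp hq0 hq2
    hδ₀ hent hG hD
  have hT0 : (0 : ℝ) < T := by exact_mod_cast hT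
  set V : ℝ := (varianceProxy F (trajectoryLaw μ T x y)).toReal with hVdef
  have hV0 : 0 ≤ V := ENNReal.toReal_nonneg
  set G : ℝ := (p * (σw : ℝ) ^ 2 / T) ^ (1 / (2 + q)) with hGdef
  set D : ℝ := (p * V) ^ (1 / (2 + q)) with hDdef
  have hG0 : 0 ≤ G := by positivity
  have hD0 : 0 ≤ D := by positivity
  set s : ℝ := Real.sqrt (1 / (2 - q)) with hs
  have hs0 : 0 ≤ s := Real.sqrt_nonneg _
  have main : ∀ ε : ℝ, 0 < ε → ENNReal.ofReal ε ≤ δ₀ →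
      expectedError μ T x fhat fstar ≤ ENNReal.ofReal (c * (s * (G + ε) + (D + ε))) := by
    intro ε hε hεδ
    -- Division by `r ≥ R` brings the critical radius below `δ₀`, at the price `A = r ^ 4`; the
    -- floor `ε` keeps the scale positive when the radius is zero.
    set γ : ℝ := max (G / r) ε with hγ
    set δ : ℝ := max (D / r) ε with hδ
    have hγε : ε ≤ γ := le_max_right _ _
    have hδε : ε ≤ δ := le_max_right _ _
    have hγ0 : 0 < γ := hε.trans_le hγε
    have hδ0 : 0 < δ := hε.trans_le hδε
    have hpow : ∀ z, ε ≤ z → ε ^ (2 + q) ≤ (r * z) ^ (2 + q) := fun z hz => by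
      gcongr
      nlinarith
    obtain ⟨p', hp', hpp', h1, h2⟩ := exists_pos_ge_and_mul_le (a := (σw : ℝ) ^ 2 / T) (b := V)
      hp (by positivity) hV0 (Real.rpow_pos_of_pos hε (2 + q)) (hpow γ hγε) (hpow δ hδε)
      (by rw [← mul_div_assoc]; exact le_mul_max_rpow (by positivity) hq0 hr1)
      (le_mul_max_rpow (by positivity) hq0 hr1)
    have hmax : ENNReal.ofReal (max γ δ) ≤ δ₀ := by
      rw [ENNReal.ofReal_max]
      exact max_le (ofReal_max_div_le hr0 (le_max_left _ _) hG hεδ)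
        (ofReal_max_div_le hr0 (le_max_left _ _) hD hεδ)
    have key := M.expectedError_le hT hF hFm hstar hV hfm hls hk0 hA hp' hq0 hq2 hγ0 hδ0
      (fun η hη hηle => by
        have hη0 : (η : ℝ≥0∞) ≤ δ₀ := by
          rw [← ENNReal.ofReal_coe_nnreal]
          exact (ENNReal.ofReal_le_ofReal hηle).trans hmax
        refine (hent η hη hη0).trans (EReal.coe_le_coe_iff.2 ?_)
        have : K ≤ k := le_max_left _ _
        gcongr)
      (by
        have := mul_one_div_rpow_le_of_le_rpow hq2 hr1 hγ0 h1
        rw [← mul_div_assoc, div_mul_eq_mul_div, div_le_iff₀ hT0] at this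
        linarith)
      (mul_one_div_rpow_le_of_le_rpow hq2 hr1 hδ0 h2)
    have hγle : γ ≤ G + ε :=
      max_le ((div_le_self hG0 hr1).trans (by linarith)) (by linarith)
    have hδle : δ ≤ D + ε :=
      max_le ((div_le_self hD0 hr1).trans (by linarith)) (by linarith)
    refine key.trans (ENNReal.ofReal_le_ofReal ?_)
    gcongr
  -- The constant `c` does not depend on `ε`, so the floor is removed by letting `ε` tend to 0.
  obtain ⟨ε₀, hε₀, hε₀δ⟩ := ENNReal.lt_iff_exists_nnreal_btwn.1 hδ₀
  have hε₀' : (0 : ℝ) < ε₀ := by exact_mod_cast hε₀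
  have hcont : Continuous fun ε : ℝ => ENNReal.ofReal (c * (s * (G + ε) + (D + ε))) :=
    ENNReal.continuous_ofReal.comp (by fun_prop)
  have hlim := (hcont.tendsto 0).mono_left (nhdsWithin_le_nhds (s := Set.Ioi 0))
  simp only [add_zero] at hlim
  refine ge_of_tendsto hlim ?_
  filter_upwards [Ioo_mem_nhdsGT hε₀'] with ε hε
  refine main ε hε.1 (le_trans ?_ hε₀δ.le)
  rw [← ENNReal.ofReal_coe_nnreal]
  exact ENNReal.ofReal_le_ofReal hε.2.le
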